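/- Let $n\ge 1$, $a=(a_0,\dots,a_{n-1})^T\in\mathbb{R}^n$, let $A_C\in\mathbb{R}^{n\times n}$ be the companion matrix with ones on the superdiagonal, last row $(-a_0,\dots,-a_{n-1})$ and zeros elsewhere, and let $e_n=(0,\dots,0,1)^T$, $\mathcal{J}=\mathrm{diag}(-1,(-1)^2,\dots,(-1)^n)$. Let $\lambda_1,\dots,\lambda_m\in\mathbb{C}$ be the distinct eigenvalues of $A_C$, with algebraic multiplicities $n_1,\dots,n_m$, and assume $\lambda_i+\lambda_j\ne 0$ for all $i,j$ (including $i=j$). No stability is assumed. The Lyapunov equation $A_CP+PA_C^T=-e_ne_n^T$ has a unique real solution $P_C$ (the infinite controllability Gramian of the companion-form system with input vector $e_n$). $P_C$ is invertible, and its inverse satisfies the Riccati equation $P_C^{-1}A_C+A_C^TP_C^{-1}=-P_C^{-1}e_ne_n^TP_C^{-1}$. There is a Jordan decomposition $A_C=M(J_1\oplus\cdots\oplus J_m)M^{-1}$ over $\mathbb{C}$, where $J_i$ is one upper Jordan block of size $n_i$ with eigenvalue $\lambda_i$. Fix any such decomposition. Let $M_i=[x^{(i)}_1,\dots,x^{(i)}_{n_i}]$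 be the block of columns of $M$, and $M_i^{(-1)}=[y^{(i)}_1,\dots,y^{(i)}_{n_i}]^T$ the block of rows of $M^{-1}$, that belong to $J_i$. Put $c^T=a^T((-1)^nI+\mathcal{J})$. Let $\mathcal{T}_i$ be the lower triangular Toeplitz $n_i\times n_i$ matrix with $(k,l)$ entry $c^Tx^{(i)}_{k-l+1}$ for $l\le k$ and $0$ otherwise, and let $\mathcal{H}_i$ be the upper Hankel $n_i\times n_i$ matrix with $(k,l)$ entry $e_n^Ty^{(i)}_{k+l-1}$ for $k+l-1\le n_i$ and $0$ otherwise. Then all $\mathcal{T}_i$ and $\mathcal{H}_i$ are invertible, and $$P_C=\sum_{i=1}^m\hat P_i^C,\qquad \hat P_i^C=M_i\mathcal{H}_i\mathcal{T}_i^{-1}M_i^T\mathcal{J},$$ $$P_C^{-1}=\sum_{j=1}^m\hat P_j^{-C},\qquad \hat P_j^{-C}=\mathcal{J}(M_j^{(-1)})^T\mathcal{T}_j\mathcal{H}_j^{-1}M_j^{(-1)},$$ and $\hat P_i^C\hat P_j^{-C}=\delta_{ij}M_iM_i^{(-1)}$ for all $i,j$. -/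

import Mathlib

open scoped Matrix

namespace CompanionGramian

/-- The companion matrix `A_C`: ones on the superdiagonal, last row `-a_0, …, -a_{n-1}`. -/
def companion {R : Type*} [CommRing R] {n : ℕ} (a : Fin n → R) : Matrix (Fin n) (Fin n) R :=
  Matrix.of fun i j =>
    if (i : ℕ) + 1 = n then - a j
    else if (j : ℕ) = (i : ℕ) + 1 then 1
    else 0

/-- The input vector `b_C = e_n = (0, …, 0, 1)ᵀ`. -/
def lastVec (R : Type*) [CommRing R] (n : ℕ) : Fin n → R :=
  fun i => if (i : ℕ) + 1 = n then 1 else 0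

/-- `𝒥 = diag(-1, (-1)², …, (-1)ⁿ)`. -/
def signMatrix (R : Type*) [CommRing R] (n : ℕ) : Matrix (Fin n) (Fin n) R :=
  Matrix.diagonal fun i => (-1) ^ ((i : ℕ) + 1)

/-- The algebraic Lyapunov equation `A_C P + P A_Cᵀ = - b_C b_Cᵀ`, whose solution is the
infinite controllability Gramian. -/
def SolvesLyapunov {n : ℕ} (a : Fin n → ℝ) (P : Matrix (Fin n) (Fin n) ℝ) : Prop :=
  companion a * P + P * (companion a)ᵀ = - Matrix.vecMulVec (lastVec ℝ n) (lastVec ℝ n)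

/-- The algebraic Riccati equation `Q A_C + A_Cᵀ Q = - Q b_C b_Cᵀ Q`. -/
def SolvesRiccati {n : ℕ} (a : Fin n → ℝ) (Q : Matrix (Fin n) (Fin n) ℝ) : Prop :=
  Q * companion a + (companion a)ᵀ * Q
    = - (Q * Matrix.vecMulVec (lastVec ℝ n) (lastVec ℝ n) * Q)

/-- The `d × d` Jordan block: `μ` on the diagonal, ones on the superdiagonal. -/
def jordanBlock (d : ℕ) (μ : ℂ) : Matrix (Fin d) (Fin d) ℂ :=
  Matrix.of fun k l => if k = l then μ else if (l : ℕ) = (k : ℕ) + 1 then 1 else 0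

/-- `A = M J M⁻¹` where `J` is the direct sum of one Jordan block of size `ν i` for each `lam i`
and `Minv` is the two-sided inverse of `M`. The column of `M` indexed by `⟨i, k⟩` is the
generalized right eigenvector `x^{(i)}_{k+1}`, the row of `Minv` indexed by `⟨i, k⟩` is the
generalized left eigenvector `y^{(i)}_{k+1}`. -/
structure IsJordanForm {n m : ℕ} (A : Matrix (Fin n) (Fin n) ℂ) (lam : Fin m → ℂ) (ν : Fin m → ℕ)
    (M : Matrix (Fin n) (Σ i, Fin (ν i)) ℂ) (Minv : Matrix (Σ i, Fin (ν i)) (Fin n) ℂ) :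
    Prop where
  mul_inv : M * Minv = 1
  inv_mul : Minv * M = 1
  eq_conj : A = M * Matrix.blockDiagonal' (fun i => jordanBlock (ν i) (lam i)) * Minv

section Blocks

variable {n m : ℕ} {ν : Fin m → ℕ}

/-- `M_i`, the columns of `M` that form the `i`-th Jordan chain. -/
def rightChain (M : Matrix (Fin n) (Σ i, Fin (ν i)) ℂ) (i : Fin m) :
    Matrix (Fin n) (Fin (ν i)) ℂ :=
  M.submatrix id fun k => ⟨i, k⟩

/-- `M_i^{(-1)}`, the rows of `M⁻¹` that belong to the `i`-th Jordan chain. -/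
def leftChain (Minv : Matrix (Σ i, Fin (ν i)) (Fin n) ℂ) (i : Fin m) :
    Matrix (Fin (ν i)) (Fin n) ℂ :=
  Minv.submatrix (fun k => ⟨i, k⟩) id

/-- `cᵀ = aᵀ ((-1)ⁿ I + 𝒥)`. -/
def cVec (a : Fin n → ℂ) : Fin n → ℂ :=
  a ᵥ* ((-1 : ℂ) ^ n • (1 : Matrix (Fin n) (Fin n) ℂ) + signMatrix ℂ n)

/-- The lower triangular Toeplitz matrix `𝒯_i`: on and below the diagonal its entry in row `k` and
column `l` (counted from `0`) is `cᵀ x^{(i)}_{k-l+1}`. -/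
def toeplitz (a : Fin n → ℂ) (M : Matrix (Fin n) (Σ i, Fin (ν i)) ℂ) (i : Fin m) :
    Matrix (Fin (ν i)) (Fin (ν i)) ℂ :=
  Matrix.of fun k l =>
    if l ≤ k then
      cVec a ⬝ᵥ fun r => rightChain M i r ⟨(k : ℕ) - (l : ℕ), (Nat.sub_le _ _).trans_lt k.isLt⟩
    else 0

/-- The upper Hankel matrix `ℋ_i`: its entry in row `k` and column `l` (counted from `0`) is
`e_nᵀ y^{(i)}_{k+l+1}`, or `0` if `k + l + 1` exceeds the length of the chain. -/
def hankel (Minv : Matrix (Σ i, Fin (ν i)) (Fin n) ℂ) (i : Fin m) :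
    Matrix (Fin (ν i)) (Fin (ν i)) ℂ :=
  Matrix.of fun k l =>
    if h : (k : ℕ) + (l : ℕ) < ν i then lastVec ℂ n ⬝ᵥ leftChain Minv i ⟨(k : ℕ) + (l : ℕ), h⟩
    else 0

/-- The eigenpart `P̂_i^C = M_i ℋ_i 𝒯_i⁻¹ M_iᵀ 𝒥`. -/
noncomputable def eigenpart (a : Fin n → ℂ) (M : Matrix (Fin n) (Σ i, Fin (ν i)) ℂ)
    (Minv : Matrix (Σ i, Fin (ν i)) (Fin n) ℂ) (i : Fin m) : Matrix (Fin n) (Fin n) ℂ :=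
  rightChain M i * hankel Minv i * (toeplitz a M i)⁻¹ * (rightChain M i)ᵀ * signMatrix ℂ n

/-- The eigenpart `P̂_j^{-C} = 𝒥 (M_j^{(-1)})ᵀ 𝒯_j ℋ_j⁻¹ M_j^{(-1)}` of the inverse. -/
noncomputable def invEigenpart (a : Fin n → ℂ) (M : Matrix (Fin n) (Σ i, Fin (ν i)) ℂ)
    (Minv : Matrix (Σ i, Fin (ν i)) (Fin n) ℂ) (j : Fin m) : Matrix (Fin n) (Fin n) ℂ :=
  signMatrix ℂ n * (leftChain Minv j)ᵀ * toeplitz a M j * (hankel Minv j)⁻¹ * leftChain Minv j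

end Blocks

end CompanionGramian

/-! Conjugation by `𝒥` changes the sign of the superdiagonal, so `𝒥` anticommutes with `A_C` up to
rank one: `A𝒥 + 𝒥A = -e_n cᵀ`. Hence if `AX = XAᵀ` and `Xc = e_n`, then `X𝒥` solves the Lyapunov
equation (`lyapunov_of_intertwine`). Take `X = ∑ M_i ℋ_i 𝒯_i⁻¹ M_iᵀ`. It intertwines `A` and `Aᵀ`
because `ℋ_i` intertwines the Jordan block with its transpose and `𝒯_i` commutes with that
transpose. It sends `c` to `e_n` because `M_iᵀ c` is the first column of `𝒯_i`, `M_i^{(-1)} e_n` is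
the first column of `ℋ_i`, and `∑ M_i M_i^{(-1)} = 1`. The solution is unique since `A` and `-Aᵀ`
share no eigenvalue. The same condition makes `𝒯_i` invertible; `ℋ_i` is invertible because no left
eigenvector of `A` is orthogonal to `e_n`. The inverse formula follows from `𝒥² = 1` and
biorthogonality of the chains. -/

namespace CompanionGramian

/-! ### Characteristic polynomial of the companion matrix -/

/-- Row `0` of the powers of a companion matrix runs through the standard basis. -/
theorem companion_pow_zero_row {R : Type*} [CommRing R] {n : ℕ} (a : Fin (n + 1) → R) :
    ∀ j : ℕ, j ≤ n → ∀ k : Fin (n + 1), (companion a ^ j) 0 k = if (k : ℕ) = j then 1 else 0 := by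
  intro j
  induction j with
  | zero =>
    intro _ k
    rw [pow_zero, Matrix.one_apply]
    simp only [Fin.ext_iff, Fin.val_zero, eq_comm]
  | succ j ih =>
    intro hj k
    rw [pow_succ, Matrix.mul_apply, Finset.sum_eq_single ⟨j, by omega⟩]
    · rw [ih (by omega)]
      simp only [companion, Matrix.of_apply]
      rw [if_pos trivial, one_mul, if_neg (by omega)]
    · intro b _ hb
      rw [ih (by omega), if_neg (fun h => hb (Fin.ext h)), zero_mul]
    · simp

theorem companion_pow_last_zero_row {R : Type*} [CommRing R] {n : ℕ} (a : Fin (n + 1) → R)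
    (k : Fin (n + 1)) : (companion a ^ (n + 1)) 0 k = - a k := by
  rw [pow_succ, Matrix.mul_apply, Finset.sum_eq_single ⟨n, by omega⟩]
  · rw [companion_pow_zero_row a n le_rfl]
    simp [companion]
  · intro b _ hb
    rw [companion_pow_zero_row a n le_rfl, if_neg (fun h => hb (Fin.ext h)), zero_mul]
  · simp

/-- This is row `0` of Cayley–Hamilton: the lower powers contribute the coefficients along the
standard basis and the top power contributes `-a`. -/
theorem companion_charpoly_coeff {R : Type*} [CommRing R] [Nontrivial R] {n : ℕ} (a : Fin n → R)
    (k : Fin n) : (companion a).charpoly.coeff k = a k := by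
  obtain _ | n := n
  · exact k.elim0
  have hm := (companion a).charpoly_monic
  have hd : (companion a).charpoly.natDegree = n + 1 := by
    simp [Matrix.charpoly_natDegree_eq_dim]
  have h := (companion a).aeval_self_charpoly
  rw [Polynomial.aeval_eq_sum_range, hd, Finset.sum_range_succ] at h
  have h0 := congrFun (congrFun h 0) k
  rw [Matrix.add_apply, Matrix.sum_apply, Finset.sum_eq_single (k : ℕ)] at h0
  · have hlead : (companion a).charpoly.coeff (n + 1) = 1 := by
      simpa only [hd] using hm.coeff_natDegree
    rw [hlead, one_smul, companion_pow_last_zero_row, Matrix.smul_apply,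
      companion_pow_zero_row a k (by omega)] at h0
    simpa [add_neg_eq_zero] using h0
  · intro j hj hjk
    rw [Matrix.smul_apply, companion_pow_zero_row a j (by simp at hj; omega),
      if_neg (Ne.symm hjk), smul_zero]
  · intro hk
    simp at hk
    omega

theorem companion_charpoly {R : Type*} [CommRing R] [Nontrivial R] {n : ℕ} (a : Fin n → R) :
    (companion a).charpoly
      = Polynomial.X ^ n + ∑ j : Fin n, Polynomial.C (a j) * Polynomial.X ^ (j : ℕ) := by
  have hm := (companion a).charpoly_monic
  have hd : (companion a).charpoly.natDegree = n := by
    simp [Matrix.charpoly_natDegree_eq_dim]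
  rw [hm.as_sum, hd, Finset.sum_range]
  simp only [companion_charpoly_coeff]

/-! ### Existence of Jordan chains via the confluent Vandermonde matrix -/

/-- The confluent Vandermonde matrix: the column `⟨i, k⟩` holds the `k`-th Taylor coefficients at
`lam i` of the monomials `1, X, …, X^{n-1}`. -/
noncomputable def confluentVandermonde (n : ℕ) {m : ℕ} (lam : Fin m → ℂ) (ν : Fin m → ℕ) :
    Matrix (Fin n) (Σ i, Fin (ν i)) ℂ :=
  Matrix.of fun r ik => (Polynomial.taylor (lam ik.1) (Polynomial.X ^ (r : ℕ))).coeff ik.2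

/-- Reading a row vector as a polynomial turns linear algebra on rows into vanishing orders at the
`lam i`. -/
theorem vecMul_confluentVandermonde {n m : ℕ} (lam : Fin m → ℂ) (ν : Fin m → ℕ) (w : Fin n → ℂ)
    (ik : Σ i, Fin (ν i)) :
    (w ᵥ* confluentVandermonde n lam ν) ik = (Polynomial.taylor (lam ik.1)
      (∑ r : Fin n, Polynomial.C (w r) * Polynomial.X ^ (r : ℕ))).coeff ik.2 := by
  simp [Matrix.vecMul, dotProduct, confluentVandermonde, Polynomial.finsetSum_coeff,
    Polynomial.taylor_mul]

/-- Recentering at `μ` turns multiplication by `X` into multiplication by `X + μ`, which acts on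
coefficients as a Jordan block. -/
theorem taylor_X_pow_succ_coeff (μ : ℂ) (r k : ℕ) :
    (Polynomial.taylor μ (Polynomial.X ^ (r + 1))).coeff k
      = μ * (Polynomial.taylor μ (Polynomial.X ^ r)).coeff k
        + if k = 0 then 0 else (Polynomial.taylor μ (Polynomial.X ^ r)).coeff (k - 1) := by
  rw [pow_succ, Polynomial.taylor_mul, Polynomial.taylor_X, mul_add, Polynomial.coeff_add,
    Polynomial.coeff_mul_C, mul_comm, mul_comm μ, add_comm]
  congr 1
  obtain _ | k := k <;> simp

theorem jordanBlock_apply (d : ℕ) (μ : ℂ) (k l : Fin d) :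
    jordanBlock d μ k l = (if k = l then μ else 0) + if (l : ℕ) = (k : ℕ) + 1 then 1 else 0 := by
  simp only [jordanBlock, Matrix.of_apply]
  by_cases h : k = l
  · subst h; simp
  · simp [h]

theorem mul_jordanBlock_apply {α : Type*} {d : ℕ} (B : Matrix α (Fin d) ℂ) (μ : ℂ) (r : α)
    (k : Fin d) : (B * jordanBlock d μ) r k
      = μ * B r k + if h : (k : ℕ) = 0 then 0 else B r ⟨(k : ℕ) - 1, by omega⟩ := by
  simp only [Matrix.mul_apply, jordanBlock_apply, mul_add, Finset.sum_add_distrib]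
  congr 1
  · simp [mul_comm]
  · split_ifs with h
    · exact Finset.sum_eq_zero fun j _ => by rw [if_neg (by omega), mul_zero]
    · rw [Finset.sum_eq_single ⟨(k : ℕ) - 1, by omega⟩]
      · rw [if_pos (by simp; omega), mul_one]
      · intro b _ hb
        rw [if_neg, mul_zero]
        intro hk
        exact hb (Fin.ext (by simp; omega))
      · simp

theorem jordanBlock_mul_apply {α : Type*} {d : ℕ} (B : Matrix (Fin d) α ℂ) (μ : ℂ) (r : α)
    (k : Fin d) : (jordanBlock d μ * B) k r
      = μ * B k r + if h : (k : ℕ) + 1 < d then B ⟨(k : ℕ) + 1, h⟩ r else 0 := by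
  simp only [Matrix.mul_apply, jordanBlock_apply, add_mul, Finset.sum_add_distrib]
  congr 1
  · simp
  · split_ifs with h
    · rw [Finset.sum_eq_single ⟨(k : ℕ) + 1, h⟩]
      · simp
      · intro b _ hb
        rw [if_neg, zero_mul]
        intro hk
        exact hb (Fin.ext hk)
      · simp
    · exact Finset.sum_eq_zero fun j _ => by rw [if_neg (by omega), zero_mul]

section Blocks

variable {n m : ℕ} {ν : Fin m → ℕ}

theorem mul_blockDiagonal'_apply (M : Matrix (Fin n) (Σ i, Fin (ν i)) ℂ)
    (D : ∀ i, Matrix (Fin (ν i)) (Fin (ν i)) ℂ) (r : Fin n) (i : Fin m) (k : Fin (ν i)) :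
    (M * Matrix.blockDiagonal' D) r ⟨i, k⟩ = (rightChain M i * D i) r k := by
  rw [Matrix.mul_apply, Fintype.sum_sigma, Finset.sum_eq_single i]
  · simp [Matrix.mul_apply, rightChain]
  · intro b _ hb
    exact Finset.sum_eq_zero fun j _ => by rw [Matrix.blockDiagonal'_apply_ne _ _ _ hb, mul_zero]
  · simp

theorem blockDiagonal'_mul_apply (N : Matrix (Σ i, Fin (ν i)) (Fin n) ℂ)
    (D : ∀ i, Matrix (Fin (ν i)) (Fin (ν i)) ℂ) (r : Fin n) (i : Fin m) (k : Fin (ν i)) :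
    (Matrix.blockDiagonal' D * N) ⟨i, k⟩ r = (D i * leftChain N i) k r := by
  rw [Matrix.mul_apply, Fintype.sum_sigma, Finset.sum_eq_single i]
  · simp [Matrix.mul_apply, leftChain]
  · intro b _ hb
    exact Finset.sum_eq_zero fun j _ => by
      rw [Matrix.blockDiagonal'_apply_ne _ _ _ hb.symm, zero_mul]
  · simp

theorem mul_blockDiagonal'_mul (M : Matrix (Fin n) (Σ i, Fin (ν i)) ℂ)
    (N : Matrix (Σ i, Fin (ν i)) (Fin n) ℂ) (D : ∀ i, Matrix (Fin (ν i)) (Fin (ν i)) ℂ) :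
    M * Matrix.blockDiagonal' D * N = ∑ i, rightChain M i * D i * leftChain N i := by
  ext r s
  simp only [Matrix.sum_apply]
  rw [Matrix.mul_apply, Fintype.sum_sigma]
  refine Finset.sum_congr rfl fun i _ => ?_
  rw [Matrix.mul_apply]
  simp only [mul_blockDiagonal'_apply]
  rfl

end Blocks

/-- On the column of monomials `A` acts as multiplication by `X` modulo the characteristic
polynomial. That polynomial vanishes to order `ν i` at `lam i`, so the Taylor coefficients of order
below `ν i` do not see the reduction. -/
theorem companion_mul_confluentVandermonde {n m : ℕ} (a : Fin n → ℂ) (lam : Fin m → ℂ)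
    (ν : Fin m → ℕ)
    (hchar : (companion a).charpoly = ∏ i, (Polynomial.X - Polynomial.C (lam i)) ^ ν i) :
    companion a * confluentVandermonde n lam ν = confluentVandermonde n lam ν
      * Matrix.blockDiagonal' (fun i => jordanBlock (ν i) (lam i)) := by
  ext r ⟨i, k⟩
  rw [mul_blockDiagonal'_apply, mul_jordanBlock_apply]
  have key : (companion a * confluentVandermonde n lam ν) r ⟨i, k⟩
      = (Polynomial.taylor (lam i) (Polynomial.X ^ ((r : ℕ) + 1))).coeff k := by
    by_cases hr : (r : ℕ) + 1 = n
    · have hrow : (companion a * confluentVandermonde n lam ν) r ⟨i, k⟩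
          = (-a ᵥ* confluentVandermonde n lam ν) ⟨i, k⟩ := by
        simp [Matrix.mul_apply, Matrix.vecMul, dotProduct, companion, hr]
      have hz : (Polynomial.taylor (lam i) (companion a).charpoly).coeff k = 0 := by
        have hdvd : (Polynomial.X - Polynomial.C (lam i)) ^ ν i ∣ (companion a).charpoly :=
          hchar ▸ Finset.dvd_prod_of_mem _ (Finset.mem_univ i)
        rw [Polynomial.X_sub_C_pow_dvd_iff] at hdvd
        exact Polynomial.X_pow_dvd_iff.1 hdvd k k.isLt
      rw [companion_charpoly, map_add, Polynomial.coeff_add] at hz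
      rw [hrow, Matrix.neg_vecMul, Pi.neg_apply, vecMul_confluentVandermonde, hr]
      exact (eq_neg_of_add_eq_zero_left hz).symm
    · rw [Matrix.mul_apply, Finset.sum_eq_single ⟨(r : ℕ) + 1, by omega⟩]
      · simp [companion, hr, confluentVandermonde]
      · intro b _ hb
        have : (b : ℕ) ≠ (r : ℕ) + 1 := fun h => hb (Fin.ext h)
        simp [companion, hr, this]
      · simp
  rw [key, taylor_X_pow_succ_coeff]
  simp [rightChain, confluentVandermonde, dite_eq_ite]

/-- A left kernel vector is a polynomial of degree below `n` divisible by a product of degree `n`.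
-/
theorem vecMul_confluentVandermonde_injective {n m : ℕ} (lam : Fin m → ℂ) (ν : Fin m → ℕ)
    (hlam : Function.Injective lam) (hn : ∑ i, ν i = n) :
    Function.Injective fun w : Fin n → ℂ => w ᵥ* confluentVandermonde n lam ν := by
  have : ∀ w : Fin n → ℂ, w ᵥ* confluentVandermonde n lam ν = 0 → w = 0 := by
    intro w hw
    set q : Polynomial ℂ := ∑ r : Fin n, Polynomial.C (w r) * Polynomial.X ^ (r : ℕ) with hq
    have hdvd : (∏ i, (Polynomial.X - Polynomial.C (lam i)) ^ ν i) ∣ q := by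
      refine Finset.prod_dvd_of_coprime (fun i _ j _ hij => ?_) fun i _ => ?_
      · exact (Polynomial.pairwise_coprime_X_sub_C hlam hij).pow
      · rw [Polynomial.X_sub_C_pow_dvd_iff, Polynomial.X_pow_dvd_iff]
        intro k hk
        have := congrFun hw ⟨i, ⟨k, hk⟩⟩
        rwa [vecMul_confluentVandermonde] at this
    have hdeg : (∏ i, (Polynomial.X - Polynomial.C (lam i)) ^ ν i).degree = (n : WithBot ℕ) := by
      rw [Polynomial.degree_prod]
      simp [← hn]
    have hqdeg : q.degree < n := Polynomial.degree_sum_fin_lt w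
    have hq0 : q = 0 := Polynomial.eq_zero_of_dvd_of_degree_lt hdvd (hdeg ▸ hqdeg)
    ext r
    have hc : q.coeff r = w r := by
      simp [hq, Polynomial.finsetSum_coeff, Polynomial.coeff_X_pow, Fin.val_inj]
    rw [← hc, hq0]
    simp
  intro v w h
  have h2 : (v - w) ᵥ* confluentVandermonde n lam ν = 0 := by
    rw [Matrix.sub_vecMul]; exact sub_eq_zero.2 h
  exact sub_eq_zero.1 (this _ h2)

theorem sum_eq_of_charpoly_eq_prod {n m : ℕ} (A : Matrix (Fin n) (Fin n) ℂ) (lam : Fin m → ℂ)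
    (ν : Fin m → ℕ) (hchar : A.charpoly = ∏ i, (Polynomial.X - Polynomial.C (lam i)) ^ ν i) :
    ∑ i, ν i = n := by
  have h1 : A.charpoly.natDegree = n := by simp [Matrix.charpoly_natDegree_eq_dim]
  rw [hchar, Polynomial.natDegree_prod_of_monic _ _
    fun i _ => (Polynomial.monic_X_sub_C _).pow _] at h1
  simpa using h1

theorem exists_isJordanForm {n m : ℕ} (a : Fin n → ℂ) (lam : Fin m → ℂ) (ν : Fin m → ℕ)
    (hlam : Function.Injective lam)
    (hchar : (companion a).charpoly = ∏ i, (Polynomial.X - Polynomial.C (lam i)) ^ ν i) :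
    ∃ M Minv, IsJordanForm (companion a) lam ν M Minv := by
  have hn := sum_eq_of_charpoly_eq_prod _ lam ν hchar
  have hcard : Fintype.card (Fin n) = Fintype.card (Σ i, Fin (ν i)) := by simp [hn]
  obtain ⟨Minv, h1⟩ : ∃ Minv : Matrix (Σ i, Fin (ν i)) (Fin n) ℂ,
      confluentVandermonde n lam ν * Minv = 1 := by
    -- Any bijection of the index types makes the matrix square, so that injectivity gives a unit.
    let e := Fintype.equivOfCardEq hcard
    have hu : IsUnit ((confluentVandermonde n lam ν).submatrix id e) := by
      rw [← Matrix.vecMul_injective_iff_isUnit]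
      intro v w h
      refine vecMul_confluentVandermonde_injective lam ν hlam hn (funext fun ik => ?_)
      have := congrFun h (e.symm ik)
      simpa [Matrix.vecMul, dotProduct] using this
    obtain ⟨B, hB⟩ := hu.exists_right_inv
    refine ⟨B.submatrix e.symm id, ?_⟩
    rw [← hB]
    ext r s
    simp only [Matrix.mul_apply, Matrix.submatrix_apply, id]
    exact (e.sum_comp fun x => confluentVandermonde n lam ν r x * B (e.symm x) s).symm.trans
      (by simp)
  have h2 := (Matrix.mul_eq_one_comm_of_equiv (Fintype.equivOfCardEq hcard)).1 h1
  refine ⟨_, Minv, h1, h2, ?_⟩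
  rw [← companion_mul_confluentVandermonde a lam ν hchar, Matrix.mul_assoc, h1, Matrix.mul_one]

/-! ### The rank-one anticommutation identity -/

section Sign

variable {n : ℕ}

theorem signMatrix_mul_self : signMatrix ℂ n * signMatrix ℂ n = 1 := by
  rw [signMatrix, Matrix.diagonal_mul_diagonal, ← Matrix.diagonal_one]
  congr 1
  ext i
  rw [← mul_pow]
  simp

theorem signMatrix_transpose : (signMatrix ℂ n)ᵀ = signMatrix ℂ n :=
  Matrix.diagonal_transpose _

/-- Neighbouring signs of `𝒥` cancel on the superdiagonal; only the last row survives, with entries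
`-a_j((-1)ⁿ + (-1)^{j+1})`. -/
theorem companion_mul_signMatrix_add (a : Fin n → ℂ) :
    companion a * signMatrix ℂ n + signMatrix ℂ n * companion a
      = - Matrix.vecMulVec (lastVec ℂ n) (cVec a) := by
  ext i j
  simp only [Matrix.add_apply, Matrix.neg_apply, Matrix.vecMulVec_apply, cVec, signMatrix,
    Matrix.vecMul_add, Matrix.vecMul_smul, Matrix.vecMul_one, Matrix.vecMul_diagonal, Pi.add_apply,
    Pi.smul_apply, smul_eq_mul, Matrix.mul_diagonal, Matrix.diagonal_mul, lastVec, companion,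
    Matrix.of_apply]
  split_ifs with h1 h2
  · rw [h1]; ring
  · rw [h2]; ring
  · ring

theorem signMatrix_mul_companion_transpose_add (a : Fin n → ℂ) :
    signMatrix ℂ n * (companion a)ᵀ + (companion a)ᵀ * signMatrix ℂ n
      = - Matrix.vecMulVec (cVec a) (lastVec ℂ n) := by
  have h := congrArg Matrix.transpose (companion_mul_signMatrix_add a)
  simpa [Matrix.transpose_mul, signMatrix_transpose, Matrix.transpose_vecMulVec] using h

/-- A matrix `X` that intertwines `A` with `Aᵀ` and maps `c` to `e_n` gives the solution `X𝒥` of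
the Lyapunov equation. -/
theorem lyapunov_of_intertwine (a : Fin n → ℂ) (X : Matrix (Fin n) (Fin n) ℂ)
    (hX : companion a * X = X * (companion a)ᵀ) (hc : X *ᵥ cVec a = lastVec ℂ n) :
    companion a * (X * signMatrix ℂ n) + X * signMatrix ℂ n * (companion a)ᵀ
      = - Matrix.vecMulVec (lastVec ℂ n) (lastVec ℂ n) := by
  rw [← Matrix.mul_assoc, hX, Matrix.mul_assoc, Matrix.mul_assoc, ← Matrix.mul_add, add_comm,
    signMatrix_mul_companion_transpose_add, Matrix.mul_neg, Matrix.mul_vecMulVec, hc]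

end Sign

/-! ### Consequences of the eigenvalue condition, and controllability -/

section Spectral

variable {n m : ℕ} {lam : Fin m → ℂ} {ν : Fin m → ℕ}

theorem exists_eq_of_isRoot_charpoly {A : Matrix (Fin n) (Fin n) ℂ}
    (hchar : A.charpoly = ∏ i, (Polynomial.X - Polynomial.C (lam i)) ^ ν i) {μ : ℂ}
    (h : A.charpoly.eval μ = 0) : ∃ i, μ = lam i := by
  rw [hchar, Polynomial.eval_prod, Finset.prod_eq_zero_iff] at h
  obtain ⟨i, -, hi⟩ := h
  refine ⟨i, ?_⟩
  rw [Polynomial.eval_pow] at hi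
  have := eq_zero_of_pow_eq_zero hi
  simpa [sub_eq_zero] using this

theorem exists_eq_of_mulVec_eq_smul {A : Matrix (Fin n) (Fin n) ℂ}
    (hchar : A.charpoly = ∏ i, (Polynomial.X - Polynomial.C (lam i)) ^ ν i) {μ : ℂ}
    {v : Fin n → ℂ} (hv : v ≠ 0) (h : A *ᵥ v = μ • v) : ∃ i, μ = lam i := by
  refine exists_eq_of_isRoot_charpoly hchar ?_
  rw [Matrix.eval_charpoly, ← Matrix.exists_mulVec_eq_zero_iff]
  refine ⟨v, hv, ?_⟩
  rw [Matrix.sub_mulVec, h, Matrix.scalar_apply, ← Matrix.smul_one_eq_diagonal,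
    Matrix.smul_mulVec, Matrix.one_mulVec, sub_self]

/-- Sylvester's argument: `AP = P(-Aᵀ)` extends to polynomials in both matrices. The characteristic
polynomial of `A` kills the left side, while its value at `-Aᵀ` is a unit. -/
theorem eq_zero_of_lyapunov_eq_zero {A : Matrix (Fin n) (Fin n) ℂ}
    (hchar : A.charpoly = ∏ i, (Polynomial.X - Polynomial.C (lam i)) ^ ν i)
    (hsum : ∀ i j, lam i + lam j ≠ 0) {P : Matrix (Fin n) (Fin n) ℂ}
    (h : A * P + P * Aᵀ = 0) : P = 0 := by
  -- Spectral mapping below needs a nonempty spectrum, which fails in size `0`.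
  obtain _ | n := n
  · exact Subsingleton.elim _ _
  have hcomm : A * P = P * (-Aᵀ) := by
    rw [Matrix.mul_neg]; exact eq_neg_of_add_eq_zero_left h
  have hpow : ∀ k : ℕ, A ^ k * P = P * (-Aᵀ) ^ k := by
    intro k
    induction k with
    | zero => simp
    | succ k ih =>
      rw [pow_succ, pow_succ, Matrix.mul_assoc, hcomm, ← Matrix.mul_assoc, ih, Matrix.mul_assoc]
  have hpoly : ∀ p : Polynomial ℂ, Polynomial.aeval A p * P = P * Polynomial.aeval (-Aᵀ) p := by
    intro p
    simp only [Polynomial.aeval_eq_sum_range, Finset.sum_mul, Finset.mul_sum, Matrix.smul_mul,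
      Matrix.mul_smul, hpow]
  have hz := hpoly A.charpoly
  rw [Matrix.aeval_self_charpoly, Matrix.zero_mul] at hz
  have hu : IsUnit (Polynomial.aeval (-Aᵀ) A.charpoly) := by
    rw [← spectrum.zero_notMem_iff ℂ, spectrum.map_polynomial_aeval_of_nonempty _ _
      (spectrum.nonempty_of_isAlgClosed_of_finiteDimensional ℂ _)]
    rintro ⟨μ, hμ, h0⟩
    obtain ⟨i, hi⟩ := exists_eq_of_isRoot_charpoly hchar h0
    rw [← spectrum.neg_eq, Set.mem_neg, Matrix.mem_spectrum_iff_isRoot_charpoly,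
      Matrix.charpoly_transpose] at hμ
    obtain ⟨j, hj⟩ := exists_eq_of_isRoot_charpoly hchar hμ
    exact hsum i j (by rw [← hi, ← hj]; ring)
  exact hu.mul_left_eq_zero.1 hz.symm

/-- If `cᵀx = 0`, the rank-one term disappears and `𝒥x` is an eigenvector for `-lam i`. -/
theorem cVec_dotProduct_ne_zero {a : Fin n → ℂ}
    (hchar : (companion a).charpoly = ∏ i, (Polynomial.X - Polynomial.C (lam i)) ^ ν i)
    (hsum : ∀ i j, lam i + lam j ≠ 0) {i : Fin m} {x : Fin n → ℂ} (hx : x ≠ 0)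
    (h : companion a *ᵥ x = lam i • x) : cVec a ⬝ᵥ x ≠ 0 := by
  intro hc
  have h1 := congrArg (· *ᵥ x) (companion_mul_signMatrix_add a)
  simp only [Matrix.add_mulVec, Matrix.neg_mulVec, Matrix.vecMulVec_mulVec, hc,
    ← Matrix.mulVec_mulVec, h, Matrix.mulVec_smul, MulOpposite.op_zero, zero_smul, neg_zero] at h1
  have hne : signMatrix ℂ n *ᵥ x ≠ 0 := by
    intro h0
    apply hx
    rw [← Matrix.one_mulVec x, ← signMatrix_mul_self, ← Matrix.mulVec_mulVec, h0,
      Matrix.mulVec_zero]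
  obtain ⟨j, hj⟩ := exists_eq_of_mulVec_eq_smul hchar hne (μ := -lam i)
    (by rw [neg_smul]; exact eq_neg_of_add_eq_zero_left h1)
  exact hsum i j (by rw [← hj]; ring)

/-- This is the eigenvector test for controllability of `(A_C, e_n)`. Once the last entry is zero,
coordinate `j + 1` of the equation reads `w_j = μ w_{j+1}`, so zeros propagate to the front. -/
theorem eq_zero_of_vecMul_companion {a : Fin n → ℂ} {μ : ℂ} {w : Fin n → ℂ}
    (h : w ᵥ* companion a = μ • w) (hw : lastVec ℂ n ⬝ᵥ w = 0) : w = 0 := by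
  have hlast : ∀ j : Fin n, (j : ℕ) + 1 = n → w j = 0 := by
    intro j hj
    rw [dotProduct, Finset.sum_eq_single j] at hw
    · simpa [lastVec, hj] using hw
    · intro b _ hb
      have : (b : ℕ) + 1 ≠ n := fun hb' => hb (Fin.ext (by omega))
      simp [lastVec, this]
    · simp
  -- Here `d` is the distance from the last coordinate.
  have key : ∀ d : ℕ, ∀ j : Fin n, (j : ℕ) + 1 + d = n → w j = 0 := by
    intro d
    induction d with
    | zero => exact hlast
    | succ d ih =>
      intro j hj
      have h1 := congrFun h ⟨(j : ℕ) + 1, by omega⟩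
      rw [Pi.smul_apply, ih _ (by simp; omega), smul_zero, Matrix.vecMul, dotProduct,
        Finset.sum_eq_single j] at h1
      · have : (j : ℕ) + 1 ≠ n := by omega
        simpa [companion, this] using h1
      · intro b _ hb
        by_cases hb' : (b : ℕ) + 1 = n
        · rw [hlast b hb', zero_mul]
        · have : (j : ℕ) ≠ b := fun h => hb (Fin.ext h.symm)
          simp [companion, hb', this]
      · simp
  ext j
  exact key (n - (j + 1)) j (by omega)

end Spectral

/-! ### Toeplitz and Hankel factors -/

section Blocks

variable {n m : ℕ} {ν : Fin m → ℕ}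

/-- Both factors are lower triangular Toeplitz: one column to the right and one row up lower `k - l`
alike. -/
theorem toeplitz_mul_jordanBlock_transpose (a : Fin n → ℂ)
    (M : Matrix (Fin n) (Σ i, Fin (ν i)) ℂ) (i : Fin m) (μ : ℂ) :
    toeplitz a M i * (jordanBlock (ν i) μ)ᵀ = (jordanBlock (ν i) μ)ᵀ * toeplitz a M i := by
  ext k l
  have h1 : (toeplitz a M i * (jordanBlock (ν i) μ)ᵀ) k l
      = (jordanBlock (ν i) μ * (toeplitz a M i)ᵀ) l k := by
    rw [← Matrix.transpose_apply (jordanBlock (ν i) μ * _), Matrix.transpose_mul,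
      Matrix.transpose_transpose]
  have h2 : ((jordanBlock (ν i) μ)ᵀ * toeplitz a M i) k l
      = ((toeplitz a M i)ᵀ * jordanBlock (ν i) μ) l k := by
    rw [← Matrix.transpose_apply (_ * jordanBlock (ν i) μ), Matrix.transpose_mul,
      Matrix.transpose_transpose]
  rw [h1, h2, jordanBlock_mul_apply, mul_jordanBlock_apply]
  congr 1
  simp only [Matrix.transpose_apply, toeplitz, Matrix.of_apply, Fin.le_def]
  split_ifs <;> first | rfl | omega | skip
  have : (k : ℕ) - ((l : ℕ) + 1) = (k : ℕ) - 1 - (l : ℕ) := by omega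
  simp only [this]

/-- Entries depend on `k + l` only, so shifting rows or columns agrees; the zero padding matches the
truncation of both shifts. -/
theorem jordanBlock_mul_hankel (Minv : Matrix (Σ i, Fin (ν i)) (Fin n) ℂ) (i : Fin m) (μ : ℂ) :
    jordanBlock (ν i) μ * hankel Minv i = hankel Minv i * (jordanBlock (ν i) μ)ᵀ := by
  ext k l
  have h1 : (hankel Minv i * (jordanBlock (ν i) μ)ᵀ) k l
      = (jordanBlock (ν i) μ * (hankel Minv i)ᵀ) l k := by
    rw [← Matrix.transpose_apply (jordanBlock (ν i) μ * _), Matrix.transpose_mul,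
      Matrix.transpose_transpose]
  rw [h1, jordanBlock_mul_apply, jordanBlock_mul_apply]
  congr 1
  simp only [Matrix.transpose_apply, hankel, Matrix.of_apply]
  split_ifs <;> first | rfl | omega | skip
  have : (k : ℕ) + 1 + (l : ℕ) = (k : ℕ) + ((l : ℕ) + 1) := by omega
  simp only [this]

theorem isUnit_toeplitz {a : Fin n → ℂ} {M : Matrix (Fin n) (Σ i, Fin (ν i)) ℂ} {i : Fin m}
    (hν : 0 < ν i) (h : (cVec a ⬝ᵥ fun r => rightChain M i r ⟨0, hν⟩) ≠ 0) :
    IsUnit (toeplitz a M i) := by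
  rw [Matrix.isUnit_iff_isUnit_det, Matrix.det_of_isLowerTriangular, isUnit_iff_ne_zero,
    Finset.prod_ne_zero_iff]
  · intro k _
    simpa [toeplitz] using h
  · intro k l hkl
    exact if_neg (not_le.2 hkl)

theorem isUnit_hankel {Minv : Matrix (Σ i, Fin (ν i)) (Fin n) ℂ} {i : Fin m} (hν : 0 < ν i)
    (h : lastVec ℂ n ⬝ᵥ leftChain Minv i ⟨ν i - 1, by omega⟩ ≠ 0) :
    IsUnit (hankel Minv i) := by
  -- Reversing the columns makes the matrix upper triangular, with the last chain vector's entry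
  -- along the diagonal.
  rw [← Matrix.isUnit_submatrix_equiv (Equiv.refl _) Fin.revPerm, Matrix.isUnit_iff_isUnit_det,
    Matrix.det_of_isUpperTriangular, isUnit_iff_ne_zero, Finset.prod_ne_zero_iff]
  · intro k _
    have hk : (k : ℕ) + (ν i - (k + 1)) = ν i - 1 := by omega
    have hlt : ν i - 1 < ν i := by omega
    simpa [hankel, hk, hlt] using h
  · intro k l hkl
    have hkl' : (l : ℕ) < k := hkl
    have : ¬ ((k : ℕ) + (ν i - (l + 1)) < ν i) := by omega
    simp [hankel, this]

variable {lam : Fin m → ℂ} {A : Matrix (Fin n) (Fin n) ℂ} {M : Matrix (Fin n) (Σ i, Fin (ν i)) ℂ}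
  {Minv : Matrix (Σ i, Fin (ν i)) (Fin n) ℂ}

/-! ### Chain relations and biorthogonality -/

namespace IsJordanForm

theorem mul_right (h : IsJordanForm A lam ν M Minv) :
    A * M = M * Matrix.blockDiagonal' (fun i => jordanBlock (ν i) (lam i)) := by
  rw [h.eq_conj, Matrix.mul_assoc, h.inv_mul, Matrix.mul_one]

theorem left_mul (h : IsJordanForm A lam ν M Minv) :
    Minv * A = Matrix.blockDiagonal' (fun i => jordanBlock (ν i) (lam i)) * Minv := by
  rw [h.eq_conj, ← Matrix.mul_assoc, ← Matrix.mul_assoc, h.inv_mul, Matrix.one_mul]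

theorem mul_rightChain (h : IsJordanForm A lam ν M Minv) (i : Fin m) :
    A * rightChain M i = rightChain M i * jordanBlock (ν i) (lam i) := by
  ext r k
  rw [← mul_blockDiagonal'_apply M (fun i => jordanBlock (ν i) (lam i)), ← h.mul_right]
  rfl

theorem leftChain_mul (h : IsJordanForm A lam ν M Minv) (i : Fin m) :
    leftChain Minv i * A = jordanBlock (ν i) (lam i) * leftChain Minv i := by
  ext k r
  rw [← blockDiagonal'_mul_apply Minv (fun i => jordanBlock (ν i) (lam i)), ← h.left_mul]
  rfl

theorem leftChain_mul_rightChain_self (h : IsJordanForm A lam ν M Minv) (i : Fin m) :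
    leftChain Minv i * rightChain M i = 1 := by
  ext k l
  have : (leftChain Minv i * rightChain M i) k l = (Minv * M) ⟨i, k⟩ ⟨i, l⟩ := rfl
  rw [this, h.inv_mul]
  simp [Matrix.one_apply]

theorem leftChain_mul_rightChain_of_ne (h : IsJordanForm A lam ν M Minv) {i j : Fin m}
    (hij : i ≠ j) : leftChain Minv i * rightChain M j = 0 := by
  ext k l
  have : (leftChain Minv i * rightChain M j) k l = (Minv * M) ⟨i, k⟩ ⟨j, l⟩ := rfl
  rw [this, h.inv_mul]
  simp [hij]

theorem sum_rightChain_mul_leftChain (h : IsJordanForm A lam ν M Minv) :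
    ∑ i, rightChain M i * leftChain Minv i = 1 := by
  have := mul_blockDiagonal'_mul M Minv (fun i => (1 : Matrix (Fin (ν i)) (Fin (ν i)) ℂ))
  simp only [Matrix.mul_one] at this
  rw [← this, ← Pi.one_def, Matrix.blockDiagonal'_one, Matrix.mul_one, h.mul_inv]

theorem rightChain_zero_ne_zero (h : IsJordanForm A lam ν M Minv) {i : Fin m} (hν : 0 < ν i) :
    (fun r => rightChain M i r ⟨0, hν⟩) ≠ 0 := by
  intro h0
  have := congrFun (congrFun (h.leftChain_mul_rightChain_self i) ⟨0, hν⟩) ⟨0, hν⟩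
  rw [Matrix.mul_apply, Matrix.one_apply_eq] at this
  simp [fun r => congrFun h0 r] at this

theorem leftChain_ne_zero (h : IsJordanForm A lam ν M Minv) (i : Fin m) (k : Fin (ν i)) :
    leftChain Minv i k ≠ 0 := by
  intro h0
  have := congrFun (congrFun (h.leftChain_mul_rightChain_self i) k) k
  rw [Matrix.mul_apply, Matrix.one_apply_eq] at this
  simp [fun r => congrFun h0 r] at this

theorem mulVec_rightChain_zero (h : IsJordanForm A lam ν M Minv) {i : Fin m} (hν : 0 < ν i) :
    A *ᵥ (fun r => rightChain M i r ⟨0, hν⟩) = lam i • fun r => rightChain M i r ⟨0, hν⟩ := by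
  ext r
  have := congrFun (congrFun (h.mul_rightChain i) r) ⟨0, hν⟩
  rw [mul_jordanBlock_apply, dif_pos rfl, add_zero] at this
  exact this

/-- Left chains of an upper Jordan block run backwards, so the true left eigenvector is the last
row, the one on the antidiagonal of `ℋ_i`. -/
theorem leftChain_last_vecMul (h : IsJordanForm A lam ν M Minv) {i : Fin m} (hν : 0 < ν i) :
    leftChain Minv i ⟨ν i - 1, by omega⟩ ᵥ* A
      = lam i • leftChain Minv i ⟨ν i - 1, by omega⟩ := by
  ext r
  have := congrFun (congrFun (h.leftChain_mul i) ⟨ν i - 1, by omega⟩) r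
  rw [jordanBlock_mul_apply, dif_neg (by simp; omega), add_zero] at this
  exact this

end IsJordanForm

theorem rightChain_transpose_mulVec_cVec (a : Fin n → ℂ) {i : Fin m} (hν : 0 < ν i) :
    (rightChain M i)ᵀ *ᵥ cVec a = toeplitz a M i *ᵥ Pi.single ⟨0, hν⟩ 1 := by
  ext k
  rw [Matrix.mulVec_single_one, Matrix.mulVec, dotProduct_comm]
  have hk : (⟨0, hν⟩ : Fin (ν i)) ≤ k := Nat.zero_le _
  change _ = toeplitz a M i k ⟨0, hν⟩
  rw [toeplitz, Matrix.of_apply, if_pos hk]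
  rfl

theorem hankel_mulVec_single {i : Fin m} (hν : 0 < ν i) :
    hankel Minv i *ᵥ Pi.single ⟨0, hν⟩ 1 = leftChain Minv i *ᵥ lastVec ℂ n := by
  ext k
  rw [Matrix.mulVec_single_one, Matrix.mulVec, dotProduct_comm]
  simp [hankel]

/-! ### Eigenparts and their products -/

variable {a : Fin n → ℂ}

/-- An eigenpart without its factor `𝒥` intertwines the companion matrix with its
transpose. -/
theorem companion_mul_eigenpart (h : IsJordanForm (companion a) lam ν M Minv) (i : Fin m)
    (hT : IsUnit (toeplitz a M i)) :
    companion a * (rightChain M i * (hankel Minv i * (toeplitz a M i)⁻¹) * (rightChain M i)ᵀ)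
      = rightChain M i * (hankel Minv i * (toeplitz a M i)⁻¹) * (rightChain M i)ᵀ
        * (companion a)ᵀ := by
  have hT' := (Matrix.isUnit_iff_isUnit_det _).1 hT
  have hinv : (jordanBlock (ν i) (lam i))ᵀ * (toeplitz a M i)⁻¹
      = (toeplitz a M i)⁻¹ * (jordanBlock (ν i) (lam i))ᵀ := by
    calc (jordanBlock (ν i) (lam i))ᵀ * (toeplitz a M i)⁻¹
        = (toeplitz a M i)⁻¹ * (toeplitz a M i * (jordanBlock (ν i) (lam i))ᵀ)
          * (toeplitz a M i)⁻¹ := by rw [Matrix.nonsing_inv_mul_cancel_left _ _ hT']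
      _ = _ := by
        rw [toeplitz_mul_jordanBlock_transpose, ← Matrix.mul_assoc,
          Matrix.mul_nonsing_inv_cancel_right _ _ hT']
  have hR := congrArg Matrix.transpose (h.mul_rightChain i)
  rw [Matrix.transpose_mul, Matrix.transpose_mul] at hR
  calc _ = companion a * rightChain M i * hankel Minv i * (toeplitz a M i)⁻¹
        * (rightChain M i)ᵀ := by simp only [Matrix.mul_assoc]
    _ = rightChain M i * (jordanBlock (ν i) (lam i) * hankel Minv i) * (toeplitz a M i)⁻¹
        * (rightChain M i)ᵀ := by rw [h.mul_rightChain]; simp only [Matrix.mul_assoc]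
    _ = rightChain M i * hankel Minv i * ((jordanBlock (ν i) (lam i))ᵀ * (toeplitz a M i)⁻¹)
        * (rightChain M i)ᵀ := by rw [jordanBlock_mul_hankel]; simp only [Matrix.mul_assoc]
    _ = rightChain M i * hankel Minv i * (toeplitz a M i)⁻¹
        * ((jordanBlock (ν i) (lam i))ᵀ * (rightChain M i)ᵀ) := by
      rw [hinv]; simp only [Matrix.mul_assoc]
    _ = _ := by rw [← hR]; simp only [Matrix.mul_assoc]

theorem sum_eigenpart_lyapunov (h : IsJordanForm (companion a) lam ν M Minv) (hν : ∀ i, 0 < ν i)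
    (hT : ∀ i, IsUnit (toeplitz a M i)) :
    companion a * (∑ i, eigenpart a M Minv i) + (∑ i, eigenpart a M Minv i) * (companion a)ᵀ
      = - Matrix.vecMulVec (lastVec ℂ n) (lastVec ℂ n) := by
  have hsplit : ∑ i, eigenpart a M Minv i
      = (∑ i, rightChain M i * (hankel Minv i * (toeplitz a M i)⁻¹) * (rightChain M i)ᵀ)
        * signMatrix ℂ n := by
    rw [Finset.sum_mul]
    simp only [eigenpart, Matrix.mul_assoc]
  rw [hsplit]
  apply lyapunov_of_intertwine
  · rw [Finset.mul_sum, Finset.sum_mul]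
    exact Finset.sum_congr rfl fun i _ => companion_mul_eigenpart h i (hT i)
  · rw [Matrix.sum_mulVec]
    -- `𝒯_i⁻¹` sends `M_iᵀ c` to the first unit vector, which `ℋ_i` sends to `M_i^{(-1)} e_n`.
    have : ∀ i, (rightChain M i * (hankel Minv i * (toeplitz a M i)⁻¹) * (rightChain M i)ᵀ)
        *ᵥ cVec a = (rightChain M i * leftChain Minv i) *ᵥ lastVec ℂ n := by
      intro i
      rw [← Matrix.mulVec_mulVec, rightChain_transpose_mulVec_cVec a (hν i), ← Matrix.mulVec_mulVec,
        ← Matrix.mulVec_mulVec, Matrix.mulVec_mulVec _ (toeplitz a M i)⁻¹,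
        Matrix.nonsing_inv_mul _ ((Matrix.isUnit_iff_isUnit_det _).1 (hT i)), Matrix.one_mulVec,
        hankel_mulVec_single, Matrix.mulVec_mulVec]
    simp only [this]
    rw [← Matrix.sum_mulVec, h.sum_rightChain_mul_leftChain, Matrix.one_mulVec]

/-- The two inner factors `𝒥` cancel, and what meets in the middle is `(M_j^{(-1)} M_i)ᵀ`, an
identity or zero. -/
theorem eigenpart_mul_invEigenpart (h : IsJordanForm A lam ν M Minv)
    (hT : ∀ i, IsUnit (toeplitz a M i)) (hH : ∀ i, IsUnit (hankel Minv i)) (i j : Fin m) :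
    eigenpart a M Minv i * invEigenpart a M Minv j
      = if i = j then rightChain M i * leftChain Minv i else 0 := by
  have hassoc : eigenpart a M Minv i * invEigenpart a M Minv j
      = rightChain M i * hankel Minv i * (toeplitz a M i)⁻¹
        * ((rightChain M i)ᵀ * (leftChain Minv j)ᵀ)
        * toeplitz a M j * (hankel Minv j)⁻¹ * leftChain Minv j := by
    calc _ = rightChain M i * hankel Minv i * (toeplitz a M i)⁻¹ * (rightChain M i)ᵀ
          * (signMatrix ℂ n * signMatrix ℂ n) * (leftChain Minv j)ᵀ
          * toeplitz a M j * (hankel Minv j)⁻¹ * leftChain Minv j := by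
          simp only [eigenpart, invEigenpart, Matrix.mul_assoc]
      _ = _ := by
          rw [signMatrix_mul_self, Matrix.mul_one]; simp only [Matrix.mul_assoc]
  rw [hassoc, ← Matrix.transpose_mul]
  split_ifs with hij
  · subst hij
    rw [h.leftChain_mul_rightChain_self, Matrix.transpose_one, Matrix.mul_one,
      Matrix.nonsing_inv_mul_cancel_right _ _ ((Matrix.isUnit_iff_isUnit_det _).1 (hT i)),
      Matrix.mul_nonsing_inv_cancel_right _ _ ((Matrix.isUnit_iff_isUnit_det _).1 (hH i))]
  · rw [h.leftChain_mul_rightChain_of_ne (Ne.symm hij)]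
    simp

theorem sum_eigenpart_mul_sum_invEigenpart (h : IsJordanForm A lam ν M Minv)
    (hT : ∀ i, IsUnit (toeplitz a M i)) (hH : ∀ i, IsUnit (hankel Minv i)) :
    (∑ i, eigenpart a M Minv i) * ∑ j, invEigenpart a M Minv j = 1 := by
  rw [Finset.sum_mul_sum]
  simp only [eigenpart_mul_invEigenpart h hT hH, Finset.sum_ite_eq, Finset.mem_univ, if_true]
  exact h.sum_rightChain_mul_leftChain

theorem IsJordanForm.isUnit_toeplitz (h : IsJordanForm (companion a) lam ν M Minv)
    (hchar : (companion a).charpoly = ∏ i, (Polynomial.X - Polynomial.C (lam i)) ^ ν i)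
    (hsum : ∀ i j, lam i + lam j ≠ 0) {i : Fin m} (hν : 0 < ν i) : IsUnit (toeplitz a M i) :=
  CompanionGramian.isUnit_toeplitz hν (cVec_dotProduct_ne_zero hchar hsum
    (h.rightChain_zero_ne_zero hν) (h.mulVec_rightChain_zero hν))

theorem IsJordanForm.isUnit_hankel (h : IsJordanForm (companion a) lam ν M Minv) {i : Fin m}
    (hν : 0 < ν i) : IsUnit (hankel Minv i) :=
  CompanionGramian.isUnit_hankel hν fun h0 => h.leftChain_ne_zero i _
    (eq_zero_of_vecMul_companion (h.leftChain_last_vecMul hν) h0)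

end Blocks

/-! ### Passage between real and complex matrices -/

section Real

variable {n : ℕ} (a : Fin n → ℝ)

theorem map_mul_ofReal (A B : Matrix (Fin n) (Fin n) ℝ) :
    (A * B).map Complex.ofReal = A.map Complex.ofReal * B.map Complex.ofReal :=
  Matrix.map_mul (f := Complex.ofRealHom)

theorem companion_map_ofReal :
    (companion a).map Complex.ofReal = companion fun k => (a k : ℂ) := by
  ext i j
  simp only [companion, Matrix.map_apply, Matrix.of_apply]
  split_ifs <;> simp

theorem vecMulVec_lastVec_map_ofReal :
    (Matrix.vecMulVec (lastVec ℝ n) (lastVec ℝ n)).map Complex.ofReal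
      = Matrix.vecMulVec (lastVec ℂ n) (lastVec ℂ n) := by
  ext i j
  simp only [Matrix.vecMulVec_apply, lastVec, Matrix.map_apply]
  split_ifs <;> simp

theorem map_lyapunov (P : Matrix (Fin n) (Fin n) ℝ) :
    (companion a * P + P * (companion a)ᵀ).map Complex.ofReal
      = (companion fun k => (a k : ℂ)) * P.map Complex.ofReal
        + P.map Complex.ofReal * (companion fun k => (a k : ℂ))ᵀ := by
  rw [Matrix.map_add _ Complex.ofReal_add, map_mul_ofReal, map_mul_ofReal, ← companion_map_ofReal,
    Matrix.transpose_map]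

/-- The Lyapunov operator is an endomorphism of a finite-dimensional real space, so injectivity,
checked over `ℂ`, gives surjectivity. -/
theorem exists_unique_solvesLyapunov {a : Fin n → ℝ} {m : ℕ} {lam : Fin m → ℂ} {ν : Fin m → ℕ}
    (hchar : (companion fun k => (a k : ℂ)).charpoly
      = ∏ i, (Polynomial.X - Polynomial.C (lam i)) ^ ν i)
    (hsum : ∀ i j, lam i + lam j ≠ 0) :
    ∃ P, ∀ Q, SolvesLyapunov a Q ↔ Q = P := by
  let f : Matrix (Fin n) (Fin n) ℝ →ₗ[ℝ] Matrix (Fin n) (Fin n) ℝ :=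
    LinearMap.mulLeft ℝ (companion a) + LinearMap.mulRight ℝ (companion a)ᵀ
  have hinj : Function.Injective f := by
    rw [injective_iff_map_eq_zero]
    intro P hP
    have hP' : companion a * P + P * (companion a)ᵀ = 0 := hP
    have h1 := map_lyapunov a P
    rw [hP', Matrix.map_zero _ Complex.ofReal_zero] at h1
    have h2 := eq_zero_of_lyapunov_eq_zero hchar hsum h1.symm
    exact Matrix.map_injective Complex.ofReal_injective
      (h2.trans (Matrix.map_zero _ Complex.ofReal_zero).symm)
  obtain ⟨P, hP⟩ := LinearMap.injective_iff_surjective.1 hinj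
    (- Matrix.vecMulVec (lastVec ℝ n) (lastVec ℝ n))
  refine ⟨P, fun Q => ⟨fun hQ => hinj (Eq.trans hQ hP.symm), ?_⟩⟩
  rintro rfl
  exact hP

/-- Multiply the Lyapunov equation by `P⁻¹` on both sides. -/
theorem SolvesLyapunov.solvesRiccati_inv {a : Fin n → ℝ} {P : Matrix (Fin n) (Fin n) ℝ}
    (h : SolvesLyapunov a P) (hP : IsUnit P) : SolvesRiccati a P⁻¹ := by
  have hd := (Matrix.isUnit_iff_isUnit_det _).1 hP
  rw [SolvesRiccati, ← Matrix.neg_mul, ← Matrix.mul_neg, ← h, Matrix.mul_add, Matrix.add_mul,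
    ← Matrix.mul_assoc, Matrix.mul_nonsing_inv_cancel_right _ _ hd,
    Matrix.nonsing_inv_mul_cancel_left _ _ hd]

theorem isUnit_of_map_ofReal_mul_eq_one {P : Matrix (Fin n) (Fin n) ℝ}
    {Y : Matrix (Fin n) (Fin n) ℂ} (h : P.map Complex.ofReal * Y = 1) : IsUnit P := by
  rw [Matrix.isUnit_iff_isUnit_det, isUnit_iff_ne_zero]
  intro h0
  have h1 : (P.map Complex.ofReal).det = 0 := by
    have := (RingHom.map_det Complex.ofRealHom P).symm
    rw [h0, map_zero] at this
    exact this
  have h2 := congrArg Matrix.det h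
  rw [Matrix.det_mul, h1, zero_mul, Matrix.det_one] at h2
  exact zero_ne_one h2

theorem inv_map_ofReal_of_mul_eq_one {P : Matrix (Fin n) (Fin n) ℝ}
    {Y : Matrix (Fin n) (Fin n) ℂ} (h : P.map Complex.ofReal * Y = 1) :
    P⁻¹.map Complex.ofReal = Y := by
  have hd := (Matrix.isUnit_iff_isUnit_det _).1 (isUnit_of_map_ofReal_mul_eq_one h)
  have h1 : P⁻¹.map Complex.ofReal * P.map Complex.ofReal = 1 := by
    rw [← map_mul_ofReal, Matrix.nonsing_inv_mul _ hd,
      Matrix.map_one _ Complex.ofReal_zero Complex.ofReal_one]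
  exact left_inv_eq_right_inv h1 h

theorem SolvesLyapunov.map_eq_sum_eigenpart {a : Fin n → ℝ} {P : Matrix (Fin n) (Fin n) ℝ}
    {m : ℕ} {lam : Fin m → ℂ} {ν : Fin m → ℕ} {M : Matrix (Fin n) (Σ i, Fin (ν i)) ℂ}
    {Minv : Matrix (Σ i, Fin (ν i)) (Fin n) ℂ} (hP : SolvesLyapunov a P)
    (hchar : (companion fun k => (a k : ℂ)).charpoly
      = ∏ i, (Polynomial.X - Polynomial.C (lam i)) ^ ν i)
    (hsum : ∀ i j, lam i + lam j ≠ 0) (hν : ∀ i, 0 < ν i)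
    (h : IsJordanForm (companion fun k => (a k : ℂ)) lam ν M Minv) :
    P.map Complex.ofReal = ∑ i, eigenpart (fun k => (a k : ℂ)) M Minv i := by
  have h1 := map_lyapunov a P
  have h2 := sum_eigenpart_lyapunov h hν fun i => h.isUnit_toeplitz hchar hsum (hν i)
  rw [show companion a * P + P * (companion a)ᵀ = _ from hP,
    Matrix.map_neg _ Complex.ofReal_neg, vecMulVec_lastVec_map_ofReal, ← h2] at h1
  refine sub_eq_zero.1 (eq_zero_of_lyapunov_eq_zero hchar hsum ?_)
  rw [Matrix.mul_sub, Matrix.sub_mul, ← add_sub_add_comm, ← h1, sub_self]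

end Real

end CompanionGramian

theorem theorem7 {n m : ℕ} (a : Fin n → ℝ) (lam : Fin m → ℂ) (ν : Fin m → ℕ)
    -- `lam` lists the distinct eigenvalues, `ν` their algebraic multiplicities
    (hlam : Function.Injective lam) (hν : ∀ i, 0 < ν i)
    (hchar : (CompanionGramian.companion fun k => (a k : ℂ)).charpoly
      = ∏ i, (Polynomial.X - Polynomial.C (lam i)) ^ ν i)
    (hsum : ∀ i j, lam i + lam j ≠ 0) :
    -- Jordan chains, one per eigenvalue, exist
    (∃ M Minv, CompanionGramian.IsJordanForm
      (CompanionGramian.companion fun k => (a k : ℂ)) lam ν M Minv) ∧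
    ∃ P : Matrix (Fin n) (Fin n) ℝ,
      -- `P` is the infinite Gramian
      (∀ Q : Matrix (Fin n) (Fin n) ℝ, CompanionGramian.SolvesLyapunov a Q ↔ Q = P) ∧
      IsUnit P ∧
      CompanionGramian.SolvesRiccati a P⁻¹ ∧
      -- for every choice of the Jordan chains
      ∀ (M : Matrix (Fin n) (Σ i, Fin (ν i)) ℂ) (Minv : Matrix (Σ i, Fin (ν i)) (Fin n) ℂ),
        CompanionGramian.IsJordanForm
          (CompanionGramian.companion fun k => (a k : ℂ)) lam ν M Minv →
        (∀ i, IsUnit (CompanionGramian.toeplitz (fun k => (a k : ℂ)) M i)) ∧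
        (∀ i, IsUnit (CompanionGramian.hankel Minv i)) ∧
        P.map Complex.ofReal
          = ∑ i, CompanionGramian.eigenpart (fun k => (a k : ℂ)) M Minv i ∧
        P⁻¹.map Complex.ofReal
          = ∑ j, CompanionGramian.invEigenpart (fun k => (a k : ℂ)) M Minv j ∧
        ∀ i j,
          CompanionGramian.eigenpart (fun k => (a k : ℂ)) M Minv i
              * CompanionGramian.invEigenpart (fun k => (a k : ℂ)) M Minv j
            = if i = j then
                CompanionGramian.rightChain M i * CompanionGramian.leftChain Minv i
              else 0 := by
  obtain ⟨P, hP⟩ := CompanionGramian.exists_unique_solvesLyapunov hchar hsum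
  have hPsol : CompanionGramian.SolvesLyapunov a P := (hP P).2 rfl
  have hex := CompanionGramian.exists_isJordanForm _ lam ν hlam hchar
  have hmul : ∀ (M : Matrix (Fin n) (Σ i, Fin (ν i)) ℂ) (Minv : Matrix (Σ i, Fin (ν i)) (Fin n) ℂ),
      CompanionGramian.IsJordanForm
        (CompanionGramian.companion fun k => (a k : ℂ)) lam ν M Minv →
      P.map Complex.ofReal
        * ∑ j, CompanionGramian.invEigenpart (fun k => (a k : ℂ)) M Minv j = 1 := by
    intro M Minv h
    rw [hPsol.map_eq_sum_eigenpart hchar hsum hν h]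
    exact CompanionGramian.sum_eigenpart_mul_sum_invEigenpart h
      (fun i => h.isUnit_toeplitz hchar hsum (hν i)) fun i => h.isUnit_hankel (hν i)
  -- Invertibility of `P` does not mention the chains, so one decomposition suffices to prove it.
  obtain ⟨M₀, Minv₀, h₀⟩ := hex
  have hu := CompanionGramian.isUnit_of_map_ofReal_mul_eq_one (hmul M₀ Minv₀ h₀)
  refine ⟨⟨M₀, Minv₀, h₀⟩, P, hP, hu, hPsol.solvesRiccati_inv hu, fun M Minv h => ?_⟩
  have hT := fun i => h.isUnit_toeplitz hchar hsum (hν i)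
  have hH := fun i => h.isUnit_hankel (hν i)
  exact ⟨hT, hH, hPsol.map_eq_sum_eigenpart hchar hsum hν h,
    CompanionGramian.inv_map_ofReal_of_mul_eq_one (hmul M Minv h),
    CompanionGramian.eigenpart_mul_invEigenpart h hT hH⟩
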